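/- **Setting.** Let $a,b\in\mathbb R^n$ with $a_i<b_i$ for all $i$, let $L=\{x\in\mathbb R^n : a\le x\le b\}$, let $g(x,k)$, $k=1,2,\dots$, be (a realization of) a discrete-time process depending on $x$, put $y(x,N)=\frac1N\sum_{k=1}^N g(x,k)$, and let $f(x)=\lim_{N\to\infty}y(x,N)$ for $x\in L$. Let $\sigma(x,N)\ge 0$ be a model of the uncertainty of $y(x,N)$ that is nonincreasing in $N\ge1$ for each $x\in L$. For $\ell\ge 0$ let $L_\ell=\{x : x_j=a_j+\frac{b_j-a_j}{2^\ell}z_j,\ z_j\in\{0,1,\dots,2^\ell\}\}$; a quantization of $x$ onto $L_\ell$ is a point of $L_\ell$ closest to $x$ in the Euclidean norm. For a Delaunay triangulation $\Delta$ of a finite set $S\subset L$ containing the vertices of $L$, the remoteness function is $e(x)=R_i^2-\|x-Z_i\|^2$ for $x$ in the simplex $\Delta_i\in\Delta$ with circumradius $R_i$ and circumcenter $Z_i$. **Algorithm ($\alpha$-DOGS).** The parameters are real numbers $\alpha^0,\beta$, real numbers $\alpha^\delta,K^0,\gamma>0$, and integers $\ell^0\ge0$, $N^0\ge1$, $N^\delta\ge1$.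 Initially $S^0$ is finite, consists of the vertices of $L$ and possibly further points of $L_{\ell^0}$, each point of $S^0$ has been sampled $N^0$ times, and $\alpha=\alpha^0$, $K=K^0$, $\ell=\ell^0$. At iteration $k\ge 0$, for $x\in S^k$ let $N^k_x$ be the current number of samples at $x$, $y_k(x)=y(x,N^k_x)$ and $\sigma_k(x)=\sigma(x,N_x^k)$. Choose a function $p^k$ that is a strict regression, i.e. $|p^k(x)-y_k(x)|\le\beta\sigma_k(x)$ for all $x\in S^k$; a Delaunay triangulation $\Delta^k$ of $S^k$, with remoteness function $e^k$; a minimizer $x_j$ over $S^k$ of $s_d^k(x)=\min\{p^k(x),2y_k(x)-p^k(x)\}-\alpha^k\sigma_k(x)$; a minimizer $z$ over $L$ of $s_c^k(x)=p^k(x)-K^ke^k(x)$; and a quantization $z_\ell$ of $z$ onto $L_\ell$, $\ell=\ell^k$. Then: * if $s_c^k(z)>s_d^k(x_j)$ and $N^k_{x_j}<\gamma 2^{\ell}$, take $N^\delta$ additional samples at $x_j$; * otherwise, if $z_\ell\notin S^k$, add $z_\ell$ to $S^k$, with $N^0$ samples; * otherwise, put $\alpha^{k+1}=\alpha^k+\alpha^\delta$,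 $K^{k+1}=2K^k$, $\ell^{k+1}=\ell^k+1$; all other quantities remain unchanged, and one passes to iteration $k+1$. All choices above are arbitrary admissible ones. **Assumptions.** 1. $f$ and the $p^k$, $k>0$, are twice differentiable on $L$, and there is a constant $\hat K$ with $-2\hat K I\preccurlyeq\nabla^2p^k(x)\preccurlyeq2\hat KI$ and $-2\hat KI\preccurlyeq\nabla^2f(x)\preccurlyeq2\hat KI$ for all $k>0$, $x\in L$. 2. There are $Q$ and a continuous nondecreasing function $E:[0,\infty)\to[0,Q]$ with $E(0)=0$, $\lim_{r\to0^+}E(r)=0$, $\lim_{r\to\infty}E(r)=Q$, such that $|y(x,N)-f(x)|\le E(\sigma(x,N))$ for all $x\in L$ and all integers $N\ge1$. 3. There are $A>0$ and $\theta\in(0,1]$ with $\sigma(x,N)\le A N^{-\theta}$ for all $x\in L$ and all integers $N\ge1$. **Theorem.** Consider any execution of the algorithm for which Assumptions 1–3 hold. For each $k$ let $\eta^k$ be a candidate point at iteration $k$, i.e. $\eta^k\in\operatorname{argmin}_{x\in S^k}\{y_k(x)+\alpha^k\sigma_k(x)\}$, and let $x^*$ be a global minimizer of $f$ over $L$. Then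 $$\lim_{k\to\infty}f(\eta^k)=f(x^*),$$ that is, the regret $f(\eta^k)-f(x^*)$ tends to $0$. -/

import Mathlib

open Filter Topology

noncomputable section

namespace AlphaDogs

/-- Euclidean `n`-space with the Euclidean norm. -/
abbrev E (n : ℕ) : Type := EuclideanSpace ℝ (Fin n)

/-- The feasible box `L = {x | a ≤ x ≤ b}`, with coordinatewise inequalities. -/
def box {n : ℕ} (a b : E n) : Set (E n) := {x | ∀ i, a i ≤ x i ∧ x i ≤ b i}

/-- The `2 ^ n` vertices of the box. -/
def boxVertices {n : ℕ} (a b : E n) : Set (E n) := {x | ∀ i, x i = a i ∨ x i = b i}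

/-- The Cartesian grid of level `l` over the box: every edge is cut into `2 ^ l` equal parts and
both end points are kept, so that there are `(2 ^ l + 1) ^ n` grid points. -/
def grid {n : ℕ} (a b : E n) (l : ℕ) : Set (E n) :=
  {x | ∀ i, ∃ m : ℕ, m ≤ 2 ^ l ∧ x i = a i + (b i - a i) / 2 ^ l * m}

/-- `q` is a quantization of `x` onto the grid of level `l`: a grid point closest to `x`. -/
def IsQuantization {n : ℕ} (a b : E n) (l : ℕ) (x q : E n) : Prop :=
  q ∈ grid a b l ∧ ∀ w ∈ grid a b l, dist x q ≤ dist x w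

/-! ### Delaunay triangulations and the remoteness function -/

/-- The closed (solid) simplex spanned by the vertices of `T`. -/
def solid {n : ℕ} (T : Affine.Simplex ℝ (E n) n) : Set (E n) :=
  convexHull ℝ (Set.range T.points)

/-- `D` is a Delaunay triangulation of the finite set `S`: a family of nondegenerate
`n`-simplices with vertices in `S`, using every point of `S`, covering the convex hull of `S`,
meeting face to face, and such that no point of `S` is strictly inside a circumsphere. -/
structure IsDelaunay {n : ℕ} (S : Finset (E n)) (D : Set (Affine.Simplex ℝ (E n) n)) : Prop where
  vertices_mem : ∀ T ∈ D, ∀ i, T.points i ∈ S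
  all_used : ∀ x ∈ S, ∃ T ∈ D, ∃ i, T.points i = x
  covers : (⋃ T ∈ D, solid T) = convexHull ℝ (S : Set (E n))
  face_to_face : ∀ T ∈ D, ∀ T' ∈ D,
    solid T ∩ solid T' = convexHull ℝ (Set.range T.points ∩ Set.range T'.points)
  empty_circumsphere : ∀ T ∈ D, ∀ x ∈ S, T.circumradius ≤ dist x T.circumcenter

/-- Local remoteness function `R² - ‖x - Z‖²` of a simplex with circumradius `R` and
circumcenter `Z`. -/
def localRemoteness {n : ℕ} (T : Affine.Simplex ℝ (E n) n) (x : E n) : ℝ :=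
  T.circumradius ^ 2 - ‖x - T.circumcenter‖ ^ 2

open Classical in
/-- Global remoteness function: the local remoteness function of a simplex of `D` containing `x`
(by `remoteness_eq` below the choice of the simplex does not matter when `D` is Delaunay);
the value `0` outside the triangulated region is never used. -/
def remoteness {n : ℕ} (D : Set (Affine.Simplex ℝ (E n) n)) (x : E n) : ℝ :=
  if h : ∃ T ∈ D, x ∈ solid T then localRemoteness h.choose x else 0

theorem localRemoteness_le {n : ℕ} {S : Finset (E n)} {D : Set (Affine.Simplex ℝ (E n) n)}
    (hD : IsDelaunay S D) {T T' : Affine.Simplex ℝ (E n) n} (hT : T ∈ D) (hT' : T' ∈ D)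
    {x : E n} (hx : x ∈ solid T) : localRemoteness T' x ≤ localRemoteness T x := by
  have key : ∀ w : E n, localRemoteness T' w ≤ localRemoteness T w ↔
      inner ℝ (T'.circumcenter - T.circumcenter) w ≤
        (T.circumradius ^ 2 - ‖T.circumcenter‖ ^ 2 - T'.circumradius ^ 2
          + ‖T'.circumcenter‖ ^ 2) / 2 := by
    intro w
    unfold localRemoteness
    rw [norm_sub_sq_real, norm_sub_sq_real, inner_sub_left, real_inner_comm w, real_inner_comm w]
    constructor <;> intro h <;> linarith
  have hconv : Convex ℝ {w : E n | inner ℝ (T'.circumcenter - T.circumcenter) w ≤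
        (T.circumradius ^ 2 - ‖T.circumcenter‖ ^ 2 - T'.circumradius ^ 2
          + ‖T'.circumcenter‖ ^ 2) / 2} :=
    convex_halfSpace_le (innerSL ℝ (T'.circumcenter - T.circumcenter)).isLinear _
  refine (key x).2 (convexHull_min ?_ hconv hx)
  rintro _ ⟨i, rfl⟩
  refine (key _).1 ?_
  have h1 := T.dist_circumcenter_eq_circumradius i
  have h2 := hD.empty_circumsphere T' hT' _ (hD.vertices_mem T hT i)
  have h3 := T'.circumradius_nonneg
  unfold localRemoteness
  rw [← dist_eq_norm, ← dist_eq_norm, h1]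
  nlinarith

/-- The remoteness function agrees on every simplex with its local remoteness function. -/
theorem remoteness_eq {n : ℕ} {S : Finset (E n)} {D : Set (Affine.Simplex ℝ (E n) n)}
    (hD : IsDelaunay S D) {T : Affine.Simplex ℝ (E n) n} (hT : T ∈ D) {x : E n}
    (hx : x ∈ solid T) : remoteness D x = localRemoteness T x := by
  have h : ∃ T ∈ D, x ∈ solid T := ⟨T, hT, hx⟩
  unfold remoteness
  rw [dif_pos h]
  exact le_antisymm (localRemoteness_le hD hT h.choose_spec.1 hx)
    (localRemoteness_le hD h.choose_spec.1 hT h.choose_spec.2)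

/-! ### Measurements -/

/-- The measurement `y(x, N) = (1 / N) ∑_{k = 1}^N g(x, k)`. -/
def meas {n : ℕ} (g : E n → ℕ → ℝ) (x : E n) (N : ℕ) : ℝ :=
  (1 / (N : ℝ)) * ∑ k ∈ Finset.Icc 1 N, g x k

/-- On `L`, `f` is the infinite-time average of the process `g`. -/
def IsTimeAverage {n : ℕ} (L : Set (E n)) (g : E n → ℕ → ℝ) (f : E n → ℝ) : Prop :=
  ∀ x ∈ L, Tendsto (fun N => meas g x N) atTop (𝓝 (f x))

/-- `σ` is an uncertainty model on `L`: `σ x N` is nonnegative and nonincreasing in the number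
`N ≥ 1` of samples. -/
structure IsUncertainty {n : ℕ} (L : Set (E n)) (σ : E n → ℕ → ℝ) : Prop where
  nonneg : ∀ x ∈ L, ∀ N, 1 ≤ N → 0 ≤ σ x N
  anti : ∀ x ∈ L, ∀ N N', 1 ≤ N → N ≤ N' → σ x N' ≤ σ x N

/-! ### The algorithm -/

/-- Parameters of the algorithm. -/
structure Params where
  (α₀ αδ K₀ γ β : ℝ)
  (l₀ N₀ Nδ : ℕ)

/-- Sign conditions on the parameters. -/
structure Params.Valid (P : Params) : Prop where
  αδ_pos : 0 < P.αδ
  K₀_pos : 0 < P.K₀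
  γ_pos : 0 < P.γ
  N₀_pos : 1 ≤ P.N₀
  Nδ_pos : 1 ≤ P.Nδ

/-- State of the algorithm at the start of an iteration: sampled points `S`, numbers of samples
`N x` (meaningful for `x ∈ S`), grid level `l`, and current values of `α` and `K`. -/
structure State (n : ℕ) where
  S : Finset (E n)
  N : E n → ℕ
  l : ℕ
  α : ℝ
  K : ℝ

/-- Current measured value at `x`. -/
def State.y {n : ℕ} (s : State n) (g : E n → ℕ → ℝ) (x : E n) : ℝ := meas g x (s.N x)

/-- Current uncertainty at `x`. -/
def State.unc {n : ℕ} (s : State n) (σ : E n → ℕ → ℝ) (x : E n) : ℝ := σ x (s.N x)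

/-- `p` is a strict regression with constant `β` of the current measurements. -/
def IsStrictRegression {n : ℕ} (g σ : E n → ℕ → ℝ) (β : ℝ) (s : State n) (p : E n → ℝ) : Prop :=
  ∀ x ∈ s.S, |p x - s.y g x| ≤ β * s.unc σ x

/-- Discrete search function `min {p, 2 y - p} - α σ`, used on `S`. -/
def discreteSearch {n : ℕ} (g σ : E n → ℕ → ℝ) (s : State n) (p : E n → ℝ) (x : E n) : ℝ :=
  min (p x) (2 * s.y g x - p x) - s.α * s.unc σ x

/-- Continuous search function `p - K e`, used on `L`. -/
def continuousSearch {n : ℕ} (s : State n) (p : E n → ℝ) (D : Set (Affine.Simplex ℝ (E n) n))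
    (x : E n) : ℝ :=
  p x - s.K * remoteness D x

/-- `s` is an initial state: `S` consists of the vertices of the box and of further points of the
initial grid, each of them sampled `N₀` times. -/
structure IsInitial {n : ℕ} (a b : E n) (P : Params) (s : State n) : Prop where
  vertices_subset : boxVertices a b ⊆ s.S
  subset_grid : (s.S : Set (E n)) ⊆ grid a b P.l₀
  samples : ∀ x ∈ s.S, s.N x = P.N₀
  level : s.l = P.l₀
  alpha : s.α = P.α₀
  K : s.K = P.K₀

open Classical in
/-- The next state, given the regression `p`, the triangulation `D`, the minimizer `xj` of the
discrete search function, the minimizer `z` of the continuous one and its quantization `zq`. The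
three cases are supplemental sampling at `xj`, identifying sampling at `zq`, grid refinement. -/
def nextState {n : ℕ} (g σ : E n → ℕ → ℝ) (P : Params) (s : State n) (p : E n → ℝ)
    (D : Set (Affine.Simplex ℝ (E n) n)) (xj z zq : E n) : State n :=
  if discreteSearch g σ s p xj < continuousSearch s p D z ∧ (s.N xj : ℝ) < P.γ * 2 ^ s.l then
    { s with N := Function.update s.N xj (s.N xj + P.Nδ) }
  else if zq ∉ s.S then
    { s with S := insert zq s.S, N := Function.update s.N zq P.N₀ }
  else
    { s with l := s.l + 1, α := s.α + P.αδ, K := 2 * s.K }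

/-- The data produced by an execution of the algorithm, iteration by iteration. -/
structure Trace (n : ℕ) where
  state : ℕ → State n
  /-- regression -/
  p : ℕ → E n → ℝ
  /-- triangulation -/
  D : ℕ → Set (Affine.Simplex ℝ (E n) n)
  /-- minimizer of the discrete search function -/
  xj : ℕ → E n
  /-- minimizer of the continuous search function -/
  z : ℕ → E n
  /-- quantization of `z` -/
  zq : ℕ → E n

/-- `t` is an (infinite) execution of the α-DOGS algorithm on the box with corners `a`, `b`, the
process `g` and the uncertainty model `σ`. All choices (regressions, triangulations, minimizers,
quantizations) are arbitrary admissible ones. -/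
structure IsRun {n : ℕ} (a b : E n) (g σ : E n → ℕ → ℝ) (P : Params) (t : Trace n) : Prop where
  initial : IsInitial a b P (t.state 0)
  regression : ∀ k, IsStrictRegression g σ P.β (t.state k) (t.p k)
  delaunay : ∀ k, IsDelaunay (t.state k).S (t.D k)
  xj_mem : ∀ k, t.xj k ∈ (t.state k).S
  xj_min : ∀ k, ∀ x ∈ (t.state k).S,
    discreteSearch g σ (t.state k) (t.p k) (t.xj k) ≤ discreteSearch g σ (t.state k) (t.p k) x
  z_mem : ∀ k, t.z k ∈ box a b
  z_min : ∀ k, ∀ x ∈ box a b,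
    continuousSearch (t.state k) (t.p k) (t.D k) (t.z k) ≤
      continuousSearch (t.state k) (t.p k) (t.D k) x
  quantization : ∀ k, IsQuantization a b (t.state k).l (t.z k) (t.zq k)
  step : ∀ k, t.state (k + 1) =
    nextState g σ P (t.state k) (t.p k) (t.D k) (t.xj k) (t.z k) (t.zq k)

/-- `η` is a candidate point in state `s`: a minimizer of `y + α σ` over `S`. -/
def IsCandidate {n : ℕ} (g σ : E n → ℕ → ℝ) (s : State n) (η : E n) : Prop :=
  η ∈ s.S ∧ ∀ x ∈ s.S, s.y g η + s.α * s.unc σ η ≤ s.y g x + s.α * s.unc σ x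

/-- The regret of the point `η` relative to the minimizer `xs`. -/
def regret {n : ℕ} (f : E n → ℝ) (xs η : E n) : ℝ := f η - f xs

/-! ### The three assumptions -/

/-- `h` is twice differentiable on `L` with `-2 C I ≼ ∇² h ≼ 2 C I` there. Derivatives are taken
relative to `L`; for a box with nonempty interior they are unique, and at every point of `L`
near which `h` has ambient derivatives they coincide with these. -/
structure HessianBound {n : ℕ} (L : Set (E n)) (C : ℝ) (h : E n → ℝ) : Prop where
  diff : DifferentiableOn ℝ h L
  diff_two : DifferentiableOn ℝ (fderivWithin ℝ h L) L
  lower : ∀ x ∈ L, ∀ v : E n,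
    -2 * C * ‖v‖ ^ 2 ≤ fderivWithin ℝ (fderivWithin ℝ h L) L x v v
  upper : ∀ x ∈ L, ∀ v : E n,
    fderivWithin ℝ (fderivWithin ℝ h L) L x v v ≤ 2 * C * ‖v‖ ^ 2

/-- Uniform bound on the Hessians of the regressions `p k`, `k > 0`, and of `f`. -/
def HessianAssumption {n : ℕ} (L : Set (E n)) (f : E n → ℝ) (p : ℕ → E n → ℝ) : Prop :=
  ∃ C : ℝ, (∀ k, 0 < k → HessianBound L C (p k)) ∧ HessianBound L C f

/-- The estimation error is bounded by a monotone function `Er : [0, ∞) → [0, Q]` of `σ`. -/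
def ErrorAssumption {n : ℕ} (L : Set (E n)) (g σ : E n → ℕ → ℝ) (f : E n → ℝ) : Prop :=
  ∃ (Q : ℝ) (Er : ℝ → ℝ),
    (∀ r, 0 ≤ r → Er r ∈ Set.Icc 0 Q) ∧
    ContinuousOn Er (Set.Ici 0) ∧
    MonotoneOn Er (Set.Ici 0) ∧
    Er 0 = 0 ∧
    Tendsto Er (𝓝[>] 0) (𝓝 0) ∧
    Tendsto Er atTop (𝓝 Q) ∧
    ∀ x ∈ L, ∀ N : ℕ, 1 ≤ N → |meas g x N - f x| ≤ Er (σ x N)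

/-- Decay of the uncertainty: `σ(x, N) ≤ A N ^ (-θ)` with `A > 0` and `θ ∈ (0, 1]`. -/
def DecayAssumption {n : ℕ} (L : Set (E n)) (σ : E n → ℕ → ℝ) : Prop :=
  ∃ A θ : ℝ, 0 < A ∧ 0 < θ ∧ θ ≤ 1 ∧
    ∀ x ∈ L, ∀ N : ℕ, 1 ≤ N → σ x N ≤ A * (N : ℝ) ^ (-θ)

end AlphaDogs

end

/-! Each grid refinement certifies a sampled point that is both accurately measured and nearly
optimal; such a point keeps its quality until the next refinement, and a candidate cannot be much
worse than it.

Refinements never stop (`IsRun.tendsto_level`), because one level leaves room for only finitely many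
other steps. So `α → ∞`, `K` grows like `2 ^ l`, and the squared mesh decays like `4 ^ (-l)`.

At a late refinement let `w` be the smaller of the two search minima. The remoteness has Hessian `-2
I` on each simplex and vanishes at its vertices, so it absorbs the curvature of `p` and `f`; for
large `K` this gives `w ≤ f x* + small` (`le_of_le_continuousSearch`). If the continuous minimum is
the smaller, minimality at `z` forces it to be at least `p` at the quantization up to `O(K * mesh²)`
(`sub_le_continuousSearch`); comparison with the discrete search there makes `α σ` small. Otherwise
the discrete minimizer has at least `γ 2 ^ l` samples, and the decay of `σ` beats the linear growth
of `α`. Both cases meet in `IsRun.exists_accurate`.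

Finally `Er r ≤ α r + ε` for large `α`, so `y + α σ + ε` bounds `f` from above at the candidate,
while at the certified point `y + α σ` is close to `f`. -/

namespace AlphaDogs

/-! ### Functions with bounded Hessian -/

section Semiconvex

variable {F : Type*} [NormedAddCommGroup F] [InnerProductSpace ℝ F]

/-- On the segment from `x` to `y`, adding `C ‖v‖² s²` makes the second derivative nonnegative, so
the claim is one-dimensional convexity. Derivatives are passed explicitly so that the lemma applies
to `-h` as well. -/
theorem le_combo_of_hessian_ge {L : Set F} (hL : Convex ℝ L) {h : F → ℝ} {h' : F → F →L[ℝ] ℝ}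
    {h'' : F → F →L[ℝ] F →L[ℝ] ℝ} {C : ℝ}
    (hd : ∀ x ∈ L, HasFDerivWithinAt h (h' x) L x)
    (hdd : ∀ x ∈ L, HasFDerivWithinAt h' (h'' x) L x)
    (low : ∀ x ∈ L, ∀ v, -2 * C * ‖v‖ ^ 2 ≤ h'' x v v)
    {x y : F} (hx : x ∈ L) (hy : y ∈ L) {t : ℝ} (ht₀ : 0 ≤ t) (ht₁ : t ≤ 1) :
    h ((1 - t) • x + t • y) ≤
      (1 - t) * h x + t * h y + C * (t * (1 - t)) * ‖x - y‖ ^ 2 := by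
  set v := y - x with hv
  let c : ℝ → F := fun s => x + s • v
  have hc : ∀ s, HasDerivAt c v s := fun s => by
    have := ((hasDerivAt_id s).smul_const v).const_add x
    rwa [one_smul] at this
  have hmaps : Set.MapsTo c (Set.Icc 0 1) L := by
    intro s hs
    have := hL hx hy (sub_nonneg.2 hs.2) hs.1 (by ring)
    have e : c s = (1 - s) • x + s • y := by simp only [c, hv]; module
    rwa [e]
  have D1 : ∀ s ∈ Set.Icc (0 : ℝ) 1, HasDerivWithinAt (fun s => h (c s) + C * ‖v‖ ^ 2 * s ^ 2)
      (h' (c s) v + C * ‖v‖ ^ 2 * (2 * s)) (Set.Icc 0 1) s := by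
    intro s hs
    have h1 := (hd _ (hmaps hs)).comp_hasDerivWithinAt s (hc s).hasDerivWithinAt hmaps
    have h2 := ((hasDerivAt_pow 2 s).const_mul (C * ‖v‖ ^ 2)).hasDerivWithinAt (s := Set.Icc 0 1)
    refine (h1.add h2).congr_deriv ?_
    simp
  have D2 : ∀ s ∈ Set.Icc (0 : ℝ) 1, HasDerivWithinAt
      (fun s => h' (c s) v + C * ‖v‖ ^ 2 * (2 * s))
      (h'' (c s) v v + C * ‖v‖ ^ 2 * 2) (Set.Icc 0 1) s := by
    intro s hs
    have h1 := (hdd _ (hmaps hs)).comp_hasDerivWithinAt s (hc s).hasDerivWithinAt hmaps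
    have h3 := h1.clm_apply (hasDerivWithinAt_const s (Set.Icc (0 : ℝ) 1) v)
    have h2 := (((hasDerivAt_id s).const_mul 2).const_mul (C * ‖v‖ ^ 2)).hasDerivWithinAt
      (s := Set.Icc 0 1)
    refine (h3.add h2).congr_deriv ?_
    simp
  have hconv : ConvexOn ℝ (Set.Icc (0 : ℝ) 1) (fun s => h (c s) + C * ‖v‖ ^ 2 * s ^ 2) := by
    refine convexOn_of_hasDerivWithinAt2_nonneg (convex_Icc 0 1)
      (fun s hs => (D1 s hs).continuousWithinAt)
      (fun s hs => (D1 s (interior_subset hs)).mono interior_subset)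
      (fun s hs => (D2 s (interior_subset hs)).mono interior_subset) (fun s hs => ?_)
    have := low _ (hmaps (interior_subset hs)) v
    linarith
  have key := hconv.2 (Set.left_mem_Icc.2 zero_le_one) (Set.right_mem_Icc.2 zero_le_one)
    (sub_nonneg.2 ht₁) ht₀ (by ring)
  have e0 : c 0 = x := by simp [c]
  have e1 : c 1 = y := by simp [c, hv]
  have et : c t = (1 - t) • x + t • y := by simp only [c, hv]; module
  simp only [smul_eq_mul, mul_zero, mul_one, zero_add, e0, e1, et] at key
  rw [norm_sub_rev x y, ← hv]
  nlinarith

theorem norm_combo_sub_sq (x y Z : F) (t : ℝ) :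
    ‖(1 - t) • x + t • y - Z‖ ^ 2 =
      (1 - t) * ‖x - Z‖ ^ 2 + t * ‖y - Z‖ ^ 2 - t * (1 - t) * ‖x - y‖ ^ 2 := by
  have e1 : (1 - t) • x + t • y - Z = (1 - t) • (x - Z) + t • (y - Z) := by module
  have e2 : x - y = (x - Z) - (y - Z) := by abel
  rw [e1, e2, norm_add_sq_real, norm_sub_sq_real (x - Z), norm_smul, norm_smul, mul_pow, mul_pow,
    inner_smul_left, inner_smul_right, Real.norm_eq_abs, Real.norm_eq_abs, sq_abs, sq_abs]
  simp only [conj_trivial]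
  ring

end Semiconvex

variable {n : ℕ}

theorem HessianBound.mono {L : Set (E n)} {C C' : ℝ} {h : E n → ℝ} (hh : HessianBound L C h)
    (hC : C ≤ C') : HessianBound L C' h where
  diff := hh.diff
  diff_two := hh.diff_two
  lower x hx v := by
    have := hh.lower x hx v
    nlinarith [sq_nonneg ‖v‖]
  upper x hx v := by
    have := hh.upper x hx v
    nlinarith [sq_nonneg ‖v‖]

theorem HessianBound.le_combo {L : Set (E n)} (hL : Convex ℝ L) {C : ℝ} {h : E n → ℝ}
    (hh : HessianBound L C h) {x y : E n} (hx : x ∈ L) (hy : y ∈ L) {t : ℝ} (ht₀ : 0 ≤ t)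
    (ht₁ : t ≤ 1) : h ((1 - t) • x + t • y) ≤
      (1 - t) * h x + t * h y + C * (t * (1 - t)) * ‖x - y‖ ^ 2 :=
  le_combo_of_hessian_ge hL (fun x hx => (hh.diff x hx).hasFDerivWithinAt)
    (fun x hx => (hh.diff_two x hx).hasFDerivWithinAt) hh.lower hx hy ht₀ ht₁

theorem HessianBound.combo_le {L : Set (E n)} (hL : Convex ℝ L) {C : ℝ} {h : E n → ℝ}
    (hh : HessianBound L C h) {x y : E n} (hx : x ∈ L) (hy : y ∈ L) {t : ℝ} (ht₀ : 0 ≤ t)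
    (ht₁ : t ≤ 1) : (1 - t) * h x + t * h y - C * (t * (1 - t)) * ‖x - y‖ ^ 2 ≤
      h ((1 - t) • x + t • y) := by
  have := le_combo_of_hessian_ge (C := C) hL (fun x hx => (hh.diff x hx).hasFDerivWithinAt.neg)
    (fun x hx => (hh.diff_two x hx).hasFDerivWithinAt.neg)
    (fun x hx v => by
      have := hh.upper x hx v
      simp only [neg_mul, neg_apply]
      linarith) hx hy ht₀ ht₁
  simp only [Pi.neg_apply] at this
  linarith

theorem localRemoteness_combo (T : Affine.Simplex ℝ (E n) n) (x y : E n) (t : ℝ) :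
    localRemoteness T ((1 - t) • x + t • y) =
      (1 - t) * localRemoteness T x + t * localRemoteness T y + t * (1 - t) * ‖x - y‖ ^ 2 := by
  unfold localRemoteness
  rw [norm_combo_sub_sq]
  ring

/-- The local remoteness has Hessian `-2 I`, so subtracting `C` times it adds `2 C I`, which
compensates the lower Hessian bound. -/
theorem HessianBound.convexOn {L : Set (E n)} (hL : Convex ℝ L) {C : ℝ} {h : E n → ℝ}
    (hh : HessianBound L C h) (T : Affine.Simplex ℝ (E n) n) :
    ConvexOn ℝ L (fun x => h x - C * localRemoteness T x) := by
  refine ⟨hL, fun x hx y hy s t _ ht hst => ?_⟩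
  obtain rfl : s = 1 - t := by linarith
  have := hh.le_combo hL hx hy ht (by linarith)
  simp only [smul_eq_mul, localRemoteness_combo]
  linarith

theorem HessianBound.concaveOn {L : Set (E n)} (hL : Convex ℝ L) {C : ℝ} {h : E n → ℝ}
    (hh : HessianBound L C h) (T : Affine.Simplex ℝ (E n) n) :
    ConcaveOn ℝ L (fun x => h x + C * localRemoteness T x) := by
  refine ⟨hL, fun x hx y hy s t _ ht hst => ?_⟩
  obtain rfl : s = 1 - t := by linarith
  have := hh.combo_le hL hx hy ht (by linarith)
  simp only [smul_eq_mul, localRemoteness_combo]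
  linarith

/-! ### The box and its grids -/

theorem convex_box (a b : E n) : Convex ℝ (box a b) := by
  intro x hx y hy s t hs ht hst i
  have h1 := hx i
  have h2 := hy i
  simp only [PiLp.add_apply, PiLp.smul_apply, smul_eq_mul]
  constructor
  · calc a i = s * a i + t * a i := by rw [← add_mul, hst, one_mul]
      _ ≤ _ := by gcongr <;> linarith
  · calc _ ≤ s * b i + t * b i := by gcongr <;> linarith
      _ = b i := by rw [← add_mul, hst, one_mul]

theorem isCompact_box (a b : E n) : IsCompact (box a b) := by
  have h : box a b = (EuclideanSpace.equiv (Fin n) ℝ).toHomeomorph ⁻¹'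
      (Set.univ.pi fun i => Set.Icc (a i) (b i)) := by
    ext x
    simp only [box, Set.mem_ofPred_eq, Set.mem_preimage, Set.mem_univ_pi, Set.mem_Icc]
    rfl
  rw [h, Homeomorph.isCompact_preimage]
  exact isCompact_univ_pi fun i => isCompact_Icc

/-- The convex hull of a product is the product of the convex hulls. With this, a triangulation of a
set containing the vertices covers the whole box. -/
theorem box_subset_convexHull {a b : E n} (hab : ∀ i, a i < b i) :
    box a b ⊆ convexHull ℝ (boxVertices a b) := by
  intro x hx
  let e := (EuclideanSpace.equiv (Fin n) ℝ).toLinearEquiv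
  have h1 : boxVertices a b = e.symm '' (Set.univ.pi fun i => {a i, b i}) := by
    rw [LinearEquiv.image_symm_eq_preimage]
    ext y
    simp [boxVertices, e]
  rw [h1, show (e.symm '' (Set.univ.pi fun i => {a i, b i}) : Set (E n)) =
    e.symm.toLinearMap '' (Set.univ.pi fun i => {a i, b i}) from rfl,
    ← LinearMap.image_convexHull, convexHull_pi]
  refine ⟨e x, fun i _ => ?_, e.symm_apply_apply x⟩
  change e x i ∈ convexHull ℝ {a i, b i}
  rw [convexHull_pair, segment_eq_Icc (hab i).le]
  exact hx i

theorem grid_subset_box {a b : E n} (hab : ∀ i, a i < b i) (l : ℕ) : grid a b l ⊆ box a b := by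
  intro x hx i
  obtain ⟨m, hm, h⟩ := hx i
  have h1 : (0 : ℝ) < 2 ^ l := by positivity
  have h2 : (m : ℝ) ≤ 2 ^ l := by exact_mod_cast hm
  have h3 := sub_pos.2 (hab i)
  rw [h]
  constructor
  · have : 0 ≤ (b i - a i) / 2 ^ l * m := by positivity
    linarith
  · have : (b i - a i) / 2 ^ l * m ≤ (b i - a i) / 2 ^ l * 2 ^ l := by gcongr
    rw [div_mul_cancel₀ _ h1.ne'] at this
    linarith

theorem finite_grid (a b : E n) (l : ℕ) : (grid a b l).Finite := by
  have h : grid a b l ⊆ (EuclideanSpace.equiv (Fin n) ℝ) ⁻¹' (Set.univ.pi fun i =>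
      (fun m : ℕ => a i + (b i - a i) / 2 ^ l * m) '' Set.Iic (2 ^ l)) := by
    intro x hx i _
    obtain ⟨m, hm, h⟩ := hx i
    exact ⟨m, hm, h.symm⟩
  exact ((Set.Finite.pi' fun i => (Set.finite_Iic _).image _).subset (by
    intro x hx i; exact hx i (Set.mem_univ i))).preimage
    (EuclideanSpace.equiv (Fin n) ℝ).injective.injOn |>.subset h

theorem exists_grid_near {a b : E n} (hab : ∀ i, a i < b i) (l : ℕ) {x : E n}
    (hx : x ∈ box a b) : ∃ w ∈ grid a b l, dist x w ≤ ‖b - a‖ / 2 ^ l := by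
  have hp : (0 : ℝ) < 2 ^ l := by positivity
  have hd : ∀ i, 0 < (b i - a i) / 2 ^ l := fun i => div_pos (sub_pos.2 (hab i)) hp
  let m : Fin n → ℕ := fun i => ⌊(x i - a i) / ((b i - a i) / 2 ^ l)⌋₊
  let w : E n := WithLp.toLp 2 fun i => a i + (b i - a i) / 2 ^ l * m i
  have hq : ∀ i, 0 ≤ (x i - a i) / ((b i - a i) / 2 ^ l) := fun i =>
    div_nonneg (sub_nonneg.2 (hx i).1) (hd i).le
  refine ⟨w, fun i => ⟨m i, ?_, rfl⟩, ?_⟩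
  · have : (m i : ℝ) ≤ 2 ^ l := by
      refine (Nat.floor_le (hq i)).trans ?_
      rw [div_le_iff₀ (hd i), mul_div_cancel₀ _ hp.ne']
      linarith [(hx i).2]
    exact_mod_cast this
  · have h1 : ‖x - w‖ ≤ ‖((2 : ℝ) ^ l)⁻¹ • (b - a)‖ := by
      rw [EuclideanSpace.norm_eq, EuclideanSpace.norm_eq]
      refine Real.sqrt_le_sqrt (Finset.sum_le_sum fun i _ => ?_)
      have e2 : (((2 : ℝ) ^ l)⁻¹ • (b - a)) i = (b i - a i) / 2 ^ l := by
        simp [div_eq_inv_mul]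
      have e1 : (x - w) i = x i - (a i + (b i - a i) / 2 ^ l * m i) := by simp [w]
      rw [e2, e1, Real.norm_eq_abs, Real.norm_eq_abs, abs_of_pos (hd i)]
      have f1 := Nat.floor_le (hq i)
      have f2 := (Nat.lt_floor_add_one ((x i - a i) / ((b i - a i) / 2 ^ l))).le
      rw [le_div_iff₀ (hd i)] at f1
      rw [div_le_iff₀ (hd i)] at f2
      refine pow_le_pow_left₀ (abs_nonneg _) (abs_le.2 ⟨?_, ?_⟩) 2 <;> simp only [m]
      · linarith [hd i]
      · linarith
    rw [dist_eq_norm]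
    refine h1.trans_eq ?_
    rw [norm_smul, norm_inv, norm_pow, Real.norm_ofNat, div_eq_inv_mul]

theorem IsQuantization.dist_le {a b : E n} (hab : ∀ i, a i < b i) {l : ℕ} {x q : E n}
    (hx : x ∈ box a b) (hq : IsQuantization a b l x q) : dist x q ≤ ‖b - a‖ / 2 ^ l := by
  obtain ⟨w, hw, h⟩ := exists_grid_near hab l hx
  exact (hq.2 w hw).trans h

/-- If a coordinate of a point is a grid value, then every quantization shares it. -/
theorem IsQuantization.eq_of_coord {a b : E n} {l : ℕ} {x q : E n}
    (hq : IsQuantization a b l x q) (i : Fin n)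
    (hi : ∃ m : ℕ, m ≤ 2 ^ l ∧ x i = a i + (b i - a i) / 2 ^ l * m) : q i = x i := by
  classical
  -- Moving coordinate `i` of `q` to `x i` stays on the grid and would be strictly closer to `x` if
  -- the two values differed.
  let w : E n := WithLp.toLp 2 (Function.update q i (x i))
  have hw : w ∈ grid a b l := by
    intro j
    rcases eq_or_ne j i with rfl | hj
    · simpa [w] using hi
    · simpa [w, hj] using hq.1 j
  have h := hq.2 w hw
  rw [EuclideanSpace.dist_eq, EuclideanSpace.dist_eq] at h
  have h' := (Real.sqrt_le_sqrt_iff (Finset.sum_nonneg fun _ _ => sq_nonneg _)).1 h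
  rw [← Finset.add_sum_erase _ _ (Finset.mem_univ i),
    ← Finset.add_sum_erase _ _ (Finset.mem_univ i)] at h'
  have e : ∑ j ∈ Finset.univ.erase i, dist (x j) (w j) ^ 2 =
      ∑ j ∈ Finset.univ.erase i, dist (x j) (q j) ^ 2 := by
    refine Finset.sum_congr rfl fun j hj => ?_
    simp [w, (Finset.mem_erase.1 hj).1]
  rw [e] at h'
  have e2 : dist (x i) (w i) = 0 := by simp [w]
  rw [e2] at h'
  have h3 : dist (x i) (q i) ^ 2 = 0 := le_antisymm (by linarith) (sq_nonneg _)
  exact (dist_eq_zero.1 (pow_eq_zero_iff two_ne_zero |>.1 h3)).symm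

/-- The reflected direction `x - q` of a quantization is feasible. -/
theorem IsQuantization.exists_reflect_mem {a b : E n} {l : ℕ} {x q : E n}
    (hx : x ∈ box a b) (hq : IsQuantization a b l x q) :
    ∃ s : ℝ, 0 < s ∧ s ≤ 1 ∧ x + s • (x - q) ∈ box a b := by
  have hi : ∀ i, ∀ᶠ s : ℝ in 𝓝[>] 0, a i ≤ x i + s * (x i - q i) ∧ x i + s * (x i - q i) ≤ b i := by
    intro i
    have ht : Tendsto (fun s : ℝ => x i + s * (x i - q i)) (𝓝[>] 0) (𝓝 (x i)) := by
      have : Continuous fun s : ℝ => x i + s * (x i - q i) := by fun_prop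
      simpa using (this.tendsto 0).mono_left nhdsWithin_le_nhds
    -- Both end points of an edge are grid values at every level, so a coordinate of `x` on the
    -- boundary does not move; any other coordinate tolerates a small move.
    rcases (hx i).1.eq_or_lt with h | h
    · have := hq.eq_of_coord i ⟨0, Nat.zero_le _, by simp [h]⟩
      simp [this, hx i]
    rcases (hx i).2.eq_or_lt with h' | h'
    · have := hq.eq_of_coord i ⟨2 ^ l, le_rfl, by
        rw [h', Nat.cast_pow, Nat.cast_ofNat, div_mul_cancel₀ _ (by positivity)]; ring⟩
      simp [this, hx i]
    · filter_upwards [ht.eventually (lt_mem_nhds h), ht.eventually (gt_mem_nhds h')] with s h1 h2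
      exact ⟨h1.le, h2.le⟩
  have h1 : ∀ᶠ s : ℝ in 𝓝[>] 0, s ∈ Set.Ioc (0 : ℝ) 1 := Ioc_mem_nhdsGT zero_lt_one
  obtain ⟨s, hs, hs1⟩ := ((eventually_all.2 hi).and h1).exists
  exact ⟨s, hs1.1, hs1.2, fun i => by simpa using hs i⟩

/-! ### Remoteness -/

section Delaunay

variable {a b : E n} {S : Finset (E n)} {D : Set (Affine.Simplex ℝ (E n) n)}

theorem IsDelaunay.exists_mem_solid (hD : IsDelaunay S D) (hab : ∀ i, a i < b i)
    (hv : boxVertices a b ⊆ S) {x : E n} (hx : x ∈ box a b) : ∃ T ∈ D, x ∈ solid T := by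
  have h := convexHull_mono hv (box_subset_convexHull hab hx)
  rw [← hD.covers] at h
  simpa using h

theorem IsDelaunay.localRemoteness_nonpos (hD : IsDelaunay S D)
    {T : Affine.Simplex ℝ (E n) n} (hT : T ∈ D) {x : E n} (hx : x ∈ S) :
    localRemoteness T x ≤ 0 := by
  have h := hD.empty_circumsphere T hT x hx
  rw [dist_eq_norm] at h
  have := pow_le_pow_left₀ T.circumradius_nonneg h 2
  unfold localRemoteness
  linarith

theorem localRemoteness_points (T : Affine.Simplex ℝ (E n) n) (i : Fin (n + 1)) :
    localRemoteness T (T.points i) = 0 := by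
  unfold localRemoteness
  rw [← dist_eq_norm, T.dist_circumcenter_eq_circumradius i, sub_self]

/-- The global remoteness is the maximum of the local ones. This lets the quadratic of one fixed
simplex be used outside that simplex. -/
theorem IsDelaunay.localRemoteness_le_remoteness (hD : IsDelaunay S D) (hab : ∀ i, a i < b i)
    (hv : boxVertices a b ⊆ S) {T : Affine.Simplex ℝ (E n) n} (hT : T ∈ D) {x : E n}
    (hx : x ∈ box a b) : localRemoteness T x ≤ remoteness D x := by
  obtain ⟨T', hT', hx'⟩ := hD.exists_mem_solid hab hv hx
  rw [remoteness_eq hD hT' hx']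
  exact localRemoteness_le hD hT' hT hx'

/-- When the quantization of the minimizer of the continuous search function has already been
sampled, the minimum is almost the value of the regression at the quantization. -/
theorem sub_le_continuousSearch {s : State n} (hD : IsDelaunay s.S D) (hab : ∀ i, a i < b i)
    (hv : boxVertices a b ⊆ s.S) {C : ℝ} (hC : 0 ≤ C) (hK : 0 ≤ s.K) {p : E n → ℝ}
    (hp : HessianBound (box a b) C p) {z q : E n} (hz : z ∈ box a b)
    (hmin : ∀ x ∈ box a b, continuousSearch s p D z ≤ continuousSearch s p D x) {l : ℕ}
    (hq : IsQuantization a b l z q) (hqS : q ∈ s.S) :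
    p q - 2 * (s.K + C) * dist z q ^ 2 ≤ continuousSearch s p D z := by
  obtain ⟨T, hT, hzT⟩ := hD.exists_mem_solid hab hv hz
  have hzval : continuousSearch s p D z = p z - s.K * localRemoteness T z := by
    rw [continuousSearch, remoteness_eq hD hT hzT]
  obtain ⟨r, hr0, hr1, hr⟩ := hq.exists_reflect_mem hz
  have hqb := grid_subset_box hab l hq.1
  -- The reflected point places `z` between two feasible points, so minimality at `z` can be used
  -- without a first-order condition on the boundary of the box.
  set x := z + r • (z - q) with hx
  have hQx : p z - s.K * localRemoteness T z ≤ p x - s.K * localRemoteness T x := by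
    rw [← hzval]
    refine (hmin x hr).trans ?_
    rw [continuousSearch]
    have := mul_le_mul_of_nonneg_left (hD.localRemoteness_le_remoteness hab hv hT hr) hK
    linarith
  have hQq : p q ≤ p q - s.K * localRemoteness T q := by
    have := mul_nonpos_of_nonneg_of_nonpos hK (hD.localRemoteness_nonpos hT hqS)
    linarith
  have h1r : 0 < 1 + r := by linarith
  -- The weight for which `z = (1 - t) x + t q`. Then `(1 - t) ‖x - q‖² = (1 + r) ‖z - q‖²`, and `r
  -- ≤ 1` gives the factor 2.
  set t := r / (1 + r) with ht
  have ht0 : 0 < t := div_pos hr0 h1r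
  have ht1 : 1 - t = (1 + r)⁻¹ := by rw [ht]; field_simp; ring
  have ht1' : t ≤ 1 := by have := inv_pos.2 h1r; linarith
  have hzc : (1 - t) • x + t • q = z := by
    rw [ht1, ht, hx]
    match_scalars
    · field_simp
    · field_simp; ring
  have hxq : ‖x - q‖ ^ 2 = (1 + r) ^ 2 * dist z q ^ 2 := by
    have : x - q = (1 + r) • (z - q) := by rw [hx]; module
    rw [this, norm_smul, Real.norm_of_nonneg h1r.le, mul_pow, dist_eq_norm]
  have h1 := hp.combo_le (convex_box a b) hr hqb ht0.le ht1'
  have h2 := localRemoteness_combo T x q t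
  rw [hzc] at h1 h2
  have h3 : (1 - t) * ‖x - q‖ ^ 2 ≤ 2 * dist z q ^ 2 := by
    rw [ht1, hxq, pow_two (1 + r), ← mul_assoc, ← mul_assoc, inv_mul_cancel₀ h1r.ne', one_mul]
    gcongr
    linarith
  have h4 : (s.K + C) * ((1 - t) * ‖x - q‖ ^ 2) ≤ (s.K + C) * (2 * dist z q ^ 2) :=
    mul_le_mul_of_nonneg_left h3 (by linarith)
  have h5 := mul_le_mul_of_nonneg_left hQx (sub_nonneg.2 ht1')
  have h6 : t * (p q - s.K * localRemoteness T q - (s.K + C) * ((1 - t) * ‖x - q‖ ^ 2)) ≤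
      t * (p z - s.K * localRemoteness T z) := by
    have h2' := congrArg (s.K * ·) h2
    linarith
  have h7 := le_of_mul_le_mul_left h6 ht0
  rw [hzval]
  linarith

/-- A number below the continuous search function at `x` and almost below `f` on `S` is almost
below `f x`. -/
theorem le_of_le_continuousSearch {s : State n} (hD : IsDelaunay s.S D) (hab : ∀ i, a i < b i)
    (hv : boxVertices a b ⊆ s.S) (hS : (s.S : Set (E n)) ⊆ box a b) {C : ℝ} (hC : 0 ≤ C)
    (hK : C < s.K) {p f : E n → ℝ} (hp : HessianBound (box a b) C p)
    (hf : HessianBound (box a b) C f) {x : E n} (hx : x ∈ box a b) {w ε B : ℝ}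
    (hε : 0 ≤ ε) (hB : 0 ≤ B) (hw : w ≤ continuousSearch s p D x) (hwf : ∀ v ∈ s.S, w ≤ f v + ε)
    (hpB : ∀ v ∈ s.S, p v ≤ f x + B) : w ≤ f x + ε + C * (B / (s.K - C)) := by
  obtain ⟨T, hT, hxT⟩ := hD.exists_mem_solid hab hv hx
  rw [continuousSearch, remoteness_eq hD hT hxT] at hw
  have hTb : Set.range T.points ⊆ box a b := by
    rintro _ ⟨i, rfl⟩
    exact hS (hD.vertices_mem T hT i)
  -- A convex function on a simplex is bounded by its largest vertex value, and the remoteness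
  -- vanishes at the vertices; `h2` is the concave counterpart for `f`.
  have h1 : p x - C * localRemoteness T x ≤ f x + B := by
    obtain ⟨_, ⟨i, rfl⟩, h⟩ :=
      (hp.convexOn (convex_box a b) T).exists_ge_of_mem_convexHull hTb hxT
    have := hpB _ (hD.vertices_mem T hT i)
    simp only [localRemoteness_points, mul_zero, sub_zero] at h
    linarith
  have h2 : w ≤ f x + C * localRemoteness T x + ε := by
    obtain ⟨_, ⟨i, rfl⟩, h⟩ :=
      (hf.concaveOn (convex_box a b) T).exists_le_of_mem_convexHull hTb hxT
    have := hwf _ (hD.vertices_mem T hT i)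
    simp only [localRemoteness_points, mul_zero, add_zero] at h
    linarith
  have hKC : 0 < s.K - C := sub_pos.2 hK
  -- With small remoteness, `h2` suffices; with large remoteness, the surplus `(K - C) e` in the
  -- search function outweighs `B`.
  rcases le_total (localRemoteness T x) (B / (s.K - C)) with h | h
  · have := mul_le_mul_of_nonneg_left h hC
    linarith
  · rw [div_le_iff₀ hKC] at h
    have : 0 ≤ C * (B / (s.K - C)) := by positivity
    linarith

end Delaunay

/-! ### Invariants of an execution -/

section Run

variable {a b : E n} {g σ : E n → ℕ → ℝ} {P : Params} {t : Trace n}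

theorem IsRun.step_cases (ht : IsRun a b g σ P t) (k : ℕ) :
    (((t.state k).N (t.xj k) : ℝ) < P.γ * 2 ^ (t.state k).l ∧
      t.state (k + 1) = { t.state k with
        N := Function.update (t.state k).N (t.xj k) ((t.state k).N (t.xj k) + P.Nδ) }) ∨
    (t.zq k ∉ (t.state k).S ∧ t.state (k + 1) = { t.state k with
        S := insert (t.zq k) (t.state k).S
        N := Function.update (t.state k).N (t.zq k) P.N₀ }) ∨
    ((continuousSearch (t.state k) (t.p k) (t.D k) (t.z k) ≤
          discreteSearch g σ (t.state k) (t.p k) (t.xj k) ∨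
        P.γ * 2 ^ (t.state k).l ≤ (t.state k).N (t.xj k)) ∧
      t.zq k ∈ (t.state k).S ∧ t.state (k + 1) = { t.state k with
        l := (t.state k).l + 1, α := (t.state k).α + P.αδ, K := 2 * (t.state k).K }) := by
  have h := ht.step k
  unfold nextState at h
  split_ifs at h with h1 h2
  · exact Or.inl ⟨h1.2, h⟩
  · refine Or.inr (Or.inr ⟨?_, h2, h⟩)
    rw [not_and_or, not_lt, not_lt] at h1
    exact h1
  · exact Or.inr (Or.inl ⟨h2, h.trans (by congr)⟩)

theorem IsRun.S_subset_succ (ht : IsRun a b g σ P t) (k : ℕ) :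
    (t.state k).S ⊆ (t.state (k + 1)).S := by
  rcases ht.step_cases k with ⟨_, h⟩ | ⟨_, h⟩ | ⟨_, _, h⟩ <;> rw [h]
  exact Finset.subset_insert _ _

theorem IsRun.N_le_succ (ht : IsRun a b g σ P t) (k : ℕ) {x : E n} (hx : x ∈ (t.state k).S) :
    (t.state k).N x ≤ (t.state (k + 1)).N x := by
  rcases ht.step_cases k with ⟨_, h⟩ | ⟨hz, h⟩ | ⟨_, _, h⟩ <;> rw [h]
  · by_cases e : x = t.xj k
    · subst e; simp
    · simp [e]
  · have e : x ≠ t.zq k := fun e => hz (e ▸ hx)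
    simp [e]

theorem IsRun.l_le_succ (ht : IsRun a b g σ P t) (k : ℕ) :
    (t.state k).l ≤ (t.state (k + 1)).l := by
  rcases ht.step_cases k with ⟨_, h⟩ | ⟨_, h⟩ | ⟨_, _, h⟩ <;> rw [h]
  exact Nat.le_succ _

theorem IsRun.vertices_subset (ht : IsRun a b g σ P t) (k : ℕ) :
    boxVertices a b ⊆ (t.state k).S := by
  induction k with
  | zero => exact ht.initial.vertices_subset
  | succ k ih => exact ih.trans (Finset.coe_subset.2 (ht.S_subset_succ k))

theorem IsRun.S_subset_box (ht : IsRun a b g σ P t) (hab : ∀ i, a i < b i) (k : ℕ) :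
    ((t.state k).S : Set (E n)) ⊆ box a b := by
  induction k with
  | zero => exact ht.initial.subset_grid.trans (grid_subset_box hab _)
  | succ k ih =>
    rcases ht.step_cases k with ⟨_, h⟩ | ⟨_, h⟩ | ⟨_, _, h⟩ <;> rw [h]
    · exact ih
    · simp only [Finset.coe_insert]
      exact Set.insert_subset (grid_subset_box hab _ (ht.quantization k).1) ih
    · exact ih

theorem IsRun.one_le_N (ht : IsRun a b g σ P t) (hP : P.Valid) (k : ℕ) {x : E n}
    (hx : x ∈ (t.state k).S) : 1 ≤ (t.state k).N x := by
  induction k with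
  | zero => exact hP.N₀_pos.trans_eq (ht.initial.samples x hx).symm
  | succ k ih =>
    by_cases hx' : x ∈ (t.state k).S
    · exact (ih hx').trans (ht.N_le_succ k hx')
    · rcases ht.step_cases k with ⟨_, h⟩ | ⟨_, h⟩ | ⟨_, _, h⟩ <;> rw [h] at hx ⊢
      · exact absurd hx hx'
      · obtain rfl := (Finset.mem_insert.1 hx).resolve_right hx'
        simpa using hP.N₀_pos
      · exact absurd hx hx'

/-- This makes `α` and `K` functions of the level alone, so all later thresholds become limits in
`l`. -/
theorem IsRun.α_K_eq (ht : IsRun a b g σ P t) (k : ℕ) :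
    P.l₀ ≤ (t.state k).l ∧ (t.state k).α = P.α₀ + P.αδ * ((t.state k).l - P.l₀) ∧
      (t.state k).K = P.K₀ * 2 ^ (t.state k).l / 2 ^ P.l₀ := by
  induction k with
  | zero =>
    rw [ht.initial.level, ht.initial.alpha, ht.initial.K]
    refine ⟨le_rfl, by ring, by field_simp⟩
  | succ k ih =>
    obtain ⟨h1, h2, h3⟩ := ih
    rcases ht.step_cases k with ⟨_, h⟩ | ⟨_, h⟩ | ⟨_, _, h⟩ <;> rw [h]
    · exact ⟨h1, h2, h3⟩
    · exact ⟨h1, h2, h3⟩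
    · refine ⟨h1.trans (Nat.le_succ _), ?_, ?_⟩
      · simp only [h2]; push_cast; ring
      · simp only [h3]; ring

/-- The grid is refined infinitely often. -/
theorem IsRun.tendsto_level (ht : IsRun a b g σ P t) (hP : P.Valid) :
    Tendsto (fun k => (t.state k).l) atTop atTop := by
  classical
  refine tendsto_atTop_atTop_of_monotone (monotone_nat_of_le_succ ht.l_le_succ) ?_
  by_contra! hbd
  obtain ⟨m, hm⟩ := hbd
  have hmono := monotone_nat_of_le_succ ht.l_le_succ
  obtain ⟨k₀, hk₀⟩ : ∃ k₀, ∀ k, k₀ ≤ k → (t.state k).l = (t.state k₀).l := by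
    have hfin : (Set.range fun k => (t.state k).l).Finite :=
      (Set.finite_Iio m).subset (by rintro _ ⟨k, rfl⟩; exact hm k)
    obtain ⟨_, ⟨⟨k₀, rfl⟩, hmax⟩⟩ :=
      hfin.exists_maximal ⟨_, Set.mem_range_self 0⟩
    exact ⟨k₀, fun k hk => le_antisymm (hmax ⟨k, rfl⟩ (hmono hk)) (hmono hk)⟩
  set l := (t.state k₀).l
  let Fs : Finset (E n) := (t.state k₀).S ∪ (finite_grid a b l).toFinset
  let M : ℕ := ⌈P.γ * 2 ^ l⌉₊
  -- Potential for a fixed level: its sum over `Fs` is bounded, yet every step without refinement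
  -- raises it. The cap `M` is harmless because supplemental sampling requires `N < γ 2 ^ l ≤ M`;
  -- the `+ 1` makes every insertion count.
  let u : ℕ → E n → ℕ := fun k x => if x ∈ (t.state k).S then min ((t.state k).N x) M + 1 else 0
  have hS : ∀ k, k₀ ≤ k → (t.state k).S ⊆ Fs := by
    intro k hk
    induction k, hk using Nat.le_induction with
    | base => exact Finset.subset_union_left
    | succ k hk ih =>
      rcases ht.step_cases k with ⟨_, h⟩ | ⟨_, h⟩ | ⟨_, _, h⟩ <;> rw [h]
      · exact ih
      · refine Finset.insert_subset ?_ ih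
        refine Finset.mem_union_right _ ((finite_grid a b l).mem_toFinset.2 ?_)
        rw [← hk₀ k hk]
        exact (ht.quantization k).1
      · exact ih
  have hu : ∀ k x, u k x ≤ u (k + 1) x := by
    intro k x
    by_cases hx : x ∈ (t.state k).S
    · simp only [u, hx, if_true, ht.S_subset_succ k hx]
      have := ht.N_le_succ k hx
      omega
    · simp [u, hx]
  have hlt : ∀ k, k₀ ≤ k → ∑ x ∈ Fs, u k x < ∑ x ∈ Fs, u (k + 1) x := by
    intro k hk
    refine Finset.sum_lt_sum (fun x _ => hu k x) ?_
    rcases ht.step_cases k with ⟨hN, h⟩ | ⟨hz, h⟩ | ⟨_, _, h⟩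
    · refine ⟨t.xj k, hS k hk (ht.xj_mem k), ?_⟩
      have h1 := ht.xj_mem k
      have h2 := ht.S_subset_succ k h1
      simp only [u, h1, h2, if_true]
      have h3 : (t.state (k + 1)).N (t.xj k) = (t.state k).N (t.xj k) + P.Nδ := by rw [h]; simp
      have h4 : (t.state k).N (t.xj k) < M := by
        rw [hk₀ k hk] at hN
        exact Nat.cast_lt.1 (hN.trans_le (Nat.le_ceil _))
      have := hP.Nδ_pos
      omega
    · have h1 : t.zq k ∈ (t.state (k + 1)).S := by rw [h]; simp
      refine ⟨t.zq k, hS (k + 1) (by omega) h1, ?_⟩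
      simp only [u, hz, h1, if_true, if_false]
      omega
    · exfalso
      have h1 := hk₀ k hk
      have h2 := hk₀ (k + 1) (by omega)
      rw [h] at h2
      simp only at h2
      omega
  have hge : ∀ j, j ≤ ∑ x ∈ Fs, u (k₀ + j) x := by
    intro j
    induction j with
    | zero => exact Nat.zero_le _
    | succ j ih =>
      have := hlt (k₀ + j) (by omega)
      rw [← add_assoc]
      omega
  have hle : ∀ k, ∑ x ∈ Fs, u k x ≤ Fs.card * (M + 1) := by
    intro k
    rw [← smul_eq_mul]
    refine Finset.sum_le_card_nsmul _ _ _ fun x _ => ?_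
    simp only [u]
    split_ifs <;> omega
  have h1 := hge (Fs.card * (M + 1) + 1)
  have h2 := hle (k₀ + (Fs.card * (M + 1) + 1))
  omega

/-- At a refinement step some sampled point is accurately measured and almost optimal. -/
theorem IsRun.exists_accurate (ht : IsRun a b g σ P t) (hab : ∀ i, a i < b i) (hP : P.Valid)
    (hσ : IsUncertainty (box a b) σ) {f : E n → ℝ} {C : ℝ} (hC : 0 ≤ C) {k : ℕ}
    (hp : HessianBound (box a b) C (t.p k)) (hf : HessianBound (box a b) C f)
    {Er : ℝ → ℝ} (hEm : MonotoneOn Er (Set.Ici 0))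
    (hEr : ∀ x ∈ box a b, ∀ N : ℕ, 1 ≤ N → |meas g x N - f x| ≤ Er (σ x N))
    {xs : E n} (hxs : xs ∈ box a b) {B ε ρ : ℝ} (hB : 0 ≤ B)
    (hpB : ∀ v ∈ (t.state k).S, t.p k v ≤ f xs + B)
    (hρ : 0 ≤ ρ) (hρε : ρ ≤ ε) (hEρ : Er ρ ≤ ε) (hβ : |P.β| * ρ ≤ ε)
    (hα : 1 ≤ (t.state k).α) (hEα : ∀ r, 0 ≤ r → Er r ≤ (t.state k).α * r + ε)
    (hK : C < (t.state k).K) (hKB : C * (B / ((t.state k).K - C)) ≤ ε)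
    (hgrid : 2 * ((t.state k).K + C) * (‖b - a‖ / 2 ^ (t.state k).l) ^ 2 ≤ ρ)
    (hN : ∀ x ∈ box a b, ∀ N : ℕ, 1 ≤ N → P.γ * 2 ^ (t.state k).l ≤ N →
      (t.state k).α * σ x N ≤ ρ)
    (hcase : continuousSearch (t.state k) (t.p k) (t.D k) (t.z k) ≤
        discreteSearch g σ (t.state k) (t.p k) (t.xj k) ∨
      P.γ * 2 ^ (t.state k).l ≤ (t.state k).N (t.xj k))
    (hzq : t.zq k ∈ (t.state k).S) :
    ∃ x ∈ (t.state k).S, (t.state k).α * (t.state k).unc σ x ≤ ρ ∧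
      (t.state k).unc σ x ≤ ρ ∧ f x ≤ f xs + 5 * ε := by
  set s := t.state k with hs
  have hv := ht.vertices_subset k
  have hS := ht.S_subset_box hab k
  have hunc : ∀ x ∈ s.S, 0 ≤ s.unc σ x := fun x hx =>
    hσ.nonneg x (hS hx) _ (ht.one_le_N hP k hx)
  have hy : ∀ x ∈ s.S, |s.y g x - f x| ≤ Er (s.unc σ x) := fun x hx =>
    hEr x (hS hx) _ (ht.one_le_N hP k hx)
  have hreg : ∀ x ∈ s.S, |t.p k x - s.y g x| ≤ |P.β| * s.unc σ x := fun x hx =>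
    (ht.regression k x hx).trans (mul_le_mul_of_nonneg_right (le_abs_self _) (hunc x hx))
  have hsmall : ∀ x ∈ s.S, s.α * s.unc σ x ≤ ρ →
      s.unc σ x ≤ ρ ∧ |s.y g x - f x| ≤ ε ∧ |t.p k x - s.y g x| ≤ ε := by
    intro x hx h
    have h0 := hunc x hx
    have h1 : s.unc σ x ≤ ρ := by nlinarith
    exact ⟨h1, (hy x hx).trans ((hEm h0 hρ h1).trans hEρ),
      (hreg x hx).trans ((mul_le_mul_of_nonneg_left h1 (abs_nonneg _)).trans hβ)⟩
  -- On `S` the discrete search is at most `y - α σ ≤ f + Er σ - α σ ≤ f + ε`. The second `ε` comes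
  -- from the term `C * (B / (K - C))`.
  have key : ∀ w, w ≤ continuousSearch s (t.p k) (t.D k) (t.z k) →
      w ≤ discreteSearch g σ s (t.p k) (t.xj k) → w ≤ f xs + 2 * ε := by
    intro w hw1 hw2
    have := le_of_le_continuousSearch (ht.delaunay k) hab hv hS hC hK hp hf hxs
      (hρ.trans hρε) hB (hw1.trans (ht.z_min k xs hxs)) (w := w) ?_ hpB
    · linarith
    · intro v hvS
      have h1 := hw2.trans (ht.xj_min k v hvS)
      have h2 := hEα _ (hunc v hvS)
      have h3 := (abs_le.1 (hy v hvS)).2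
      have h4 : min (t.p k v) (2 * s.y g v - t.p k v) ≤ s.y g v := by
        rcases le_total (t.p k v) (s.y g v) with h | h
        · exact (min_le_left _ _).trans h
        · exact (min_le_right _ _).trans (by linarith)
      rw [discreteSearch, ← hs] at h1
      linarith
  have hB' : continuousSearch s (t.p k) (t.D k) (t.z k) ≤
      discreteSearch g σ s (t.p k) (t.xj k) → ∃ x ∈ s.S, s.α * s.unc σ x ≤ ρ ∧
      s.unc σ x ≤ ρ ∧ f x ≤ f xs + 5 * ε := by
    intro hle
    have h1 := sub_le_continuousSearch (ht.delaunay k) hab hv hC (hC.trans hK.le) hp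
      (ht.z_mem k) (ht.z_min k) (ht.quantization k) hzq
    have h2 : 2 * (s.K + C) * dist (t.z k) (t.zq k) ^ 2 ≤ ρ := by
      refine le_trans ?_ hgrid
      have := (ht.quantization k).dist_le hab (ht.z_mem k)
      have h0 : 0 ≤ s.K + C := by linarith
      gcongr
    have h3 := hle.trans (ht.xj_min k _ hzq)
    have h4 := min_le_left (t.p k (t.zq k)) (2 * s.y g (t.zq k) - t.p k (t.zq k))
    -- The chain `p q - ρ ≤ s_c(z) ≤ s_d(q) ≤ p q - α σ(q)`, with `q` the quantization: `p q`
    -- cancels.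
    have h5 : s.α * s.unc σ (t.zq k) ≤ ρ := by
      rw [discreteSearch, ← hs] at h3
      linarith
    obtain ⟨h6, h7, h8⟩ := hsmall _ hzq h5
    have h9 := key _ le_rfl hle
    have h10 := (abs_le.1 h7).1
    have h11 := (abs_le.1 h8).1
    exact ⟨_, hzq, h5, h6, by linarith⟩
  rcases hcase with hle | hsamp
  · exact hB' hle
  rcases le_total (continuousSearch s (t.p k) (t.D k) (t.z k))
    (discreteSearch g σ s (t.p k) (t.xj k)) with hle | hle
  · exact hB' hle
  · have hj := ht.xj_mem k
    have h5 : s.α * s.unc σ (t.xj k) ≤ ρ := hN _ (hS hj) _ (ht.one_le_N hP k hj) hsamp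
    obtain ⟨h6, h7, h8⟩ := hsmall _ hj h5
    have h9 := key _ hle le_rfl
    have h10 := abs_le.1 h7
    have h11 := abs_le.1 h8
    have h12 : s.y g (t.xj k) - ε ≤
        min (t.p k (t.xj k)) (2 * s.y g (t.xj k) - t.p k (t.xj k)) :=
      le_min (by linarith) (by linarith)
    rw [discreteSearch] at h9
    exact ⟨_, hj, h5, h6, by linarith⟩

end Run

/-! ### Growth of the parameters with the level -/

theorem Params.tendsto_alpha {P : Params} (hP : P.Valid) :
    Tendsto (fun l : ℕ => P.α₀ + P.αδ * (l - P.l₀)) atTop atTop :=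
  tendsto_atTop_add_const_left _ _
    ((tendsto_atTop_add_const_right _ (-(P.l₀ : ℝ)) tendsto_natCast_atTop_atTop).const_mul_atTop
      hP.αδ_pos)

theorem Params.tendsto_K {P : Params} (hP : P.Valid) :
    Tendsto (fun l : ℕ => P.K₀ * 2 ^ l / 2 ^ P.l₀) atTop atTop :=
  ((tendsto_pow_atTop_atTop_of_one_lt one_lt_two).const_mul_atTop hP.K₀_pos).atTop_div_const
    (by positivity)

theorem Params.tendsto_K_mul_sq (P : Params) (C d : ℝ) :
    Tendsto (fun l : ℕ => 2 * (P.K₀ * 2 ^ l / 2 ^ P.l₀ + C) * (d / 2 ^ l) ^ 2) atTop (𝓝 0) := by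
  have h1 : Tendsto (fun l : ℕ => ((1 : ℝ) / 2) ^ l) atTop (𝓝 0) :=
    tendsto_pow_atTop_nhds_zero_of_lt_one (by norm_num) (by norm_num)
  have h2 := (h1.const_mul (2 * P.K₀ / 2 ^ P.l₀ * d ^ 2)).add
    ((h1.mul h1).const_mul (2 * C * d ^ 2))
  simp only [mul_zero, add_zero] at h2
  refine h2.congr fun l => ?_
  rw [one_div, inv_pow]
  field_simp

/-- The geometric decay of `(2 ^ (-θ)) ^ l` beats the linear growth of `α`. -/
theorem Params.tendsto_alpha_mul_rpow {P : Params} (hP : P.Valid) (A : ℝ) {θ : ℝ} (hθ : 0 < θ) :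
    Tendsto (fun l : ℕ => (P.α₀ + P.αδ * (l - P.l₀)) * (A * (P.γ * 2 ^ l) ^ (-θ))) atTop
      (𝓝 0) := by
  have hr0 : 0 ≤ (2 : ℝ) ^ (-θ) := by positivity
  have hr1 : (2 : ℝ) ^ (-θ) < 1 := Real.rpow_lt_one_of_one_lt_of_neg one_lt_two (by linarith)
  have h1 := tendsto_pow_atTop_nhds_zero_of_lt_one hr0 hr1
  have h2 := tendsto_self_mul_const_pow_of_lt_one hr0 hr1
  have h3 := (h1.const_mul ((P.α₀ - P.αδ * P.l₀) * (A * P.γ ^ (-θ)))).add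
    (h2.const_mul (P.αδ * (A * P.γ ^ (-θ))))
  simp only [mul_zero, add_zero] at h3
  refine h3.congr fun l => ?_
  rw [Real.mul_rpow hP.γ_pos.le (by positivity), ← Real.rpow_natCast, ← Real.rpow_natCast 2 l,
    ← Real.rpow_mul zero_le_two, ← Real.rpow_mul zero_le_two, mul_comm (-θ)]
  ring

/-! ### Near-optimality of the candidate points -/

section Run

variable {a b : E n} {g σ : E n → ℕ → ℝ} {P : Params} {t : Trace n}

theorem IsRun.eventually_candidate_le (ht : IsRun a b g σ P t) (hab : ∀ i, a i < b i)
    (hP : P.Valid) (hσ : IsUncertainty (box a b) σ) {f : E n → ℝ}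
    (h1 : HessianAssumption (box a b) f t.p) (h2 : ErrorAssumption (box a b) g σ f)
    (h3 : DecayAssumption (box a b) σ) {η : ℕ → E n}
    (hη : ∀ k, IsCandidate g σ (t.state k) (η k)) {xs : E n} (hxs : xs ∈ box a b) {ε : ℝ}
    (hε : 0 < ε) : ∀ᶠ k in atTop, f (η k) ≤ f xs + 9 * ε := by
  obtain ⟨C₀, hp, hf⟩ := h1
  obtain ⟨Q, Er, hErQ, -, hEm, -, hE0, -, hEr⟩ := h2
  obtain ⟨A, θ, hA, hθ, -, hdec⟩ := h3
  set C := max C₀ 0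
  have hC : 0 ≤ C := le_max_right _ _
  replace hp := fun k hk => (hp k hk).mono (le_max_left C₀ 0)
  replace hf := hf.mono (le_max_left C₀ 0)
  have hQ : 0 ≤ Q := (hErQ 0 le_rfl).1.trans (hErQ 0 le_rfl).2
  have hσA : ∀ x ∈ box a b, ∀ N : ℕ, 1 ≤ N → σ x N ≤ A := fun x hx N hN =>
    (hdec x hx N hN).trans (mul_le_of_le_one_right hA.le
      (Real.rpow_le_one_of_one_le_of_nonpos (by exact_mod_cast hN) (by linarith)))
  obtain ⟨Fm, hFm⟩ := (isCompact_box a b).bddAbove_image hf.diff.continuousOn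
  -- A bound on `p - f xs` over all sampled points and iterations: `f ≤ Fm`, `|y - f| ≤ Q`, and `|p
  -- - y| ≤ |β| A` since `σ ≤ A`.
  set B := max 0 (Fm + Q + |P.β| * A - f xs)
  have hpB : ∀ k, ∀ v ∈ (t.state k).S, t.p k v ≤ f xs + B := by
    intro k v hv
    have hvb := ht.S_subset_box hab k hv
    have hN := ht.one_le_N hP k hv
    have e1 := hσ.nonneg v hvb _ hN
    have e2 := (abs_le.1 (hEr v hvb _ hN)).2
    have e3 := (hErQ _ e1).2
    have e4 := (abs_le.1 (ht.regression k v hv)).2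
    have e5 : P.β * (t.state k).unc σ v ≤ |P.β| * A :=
      mul_le_mul (le_abs_self _) (hσA v hvb _ hN) e1 (abs_nonneg _)
    have e6 := hFm (Set.mem_image_of_mem f hvb)
    have e7 := le_max_right 0 (Fm + Q + |P.β| * A - f xs)
    unfold State.y at e4
    linarith
  obtain ⟨ρ, hEρ, hβρ, hρε, hρ⟩ : ∃ ρ, Er ρ ≤ ε ∧ |P.β| * ρ ≤ ε ∧ ρ ≤ ε ∧ 0 < ρ := by
    have e1 : ∀ᶠ r in 𝓝[>] (0 : ℝ), Er r < ε := hE0.eventually (gt_mem_nhds hε)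
    have e2 : Tendsto (fun r : ℝ => |P.β| * r) (𝓝[>] 0) (𝓝 0) := by
      have : Continuous fun r : ℝ => |P.β| * r := by fun_prop
      simpa using (this.tendsto 0).mono_left nhdsWithin_le_nhds
    have e3 : ∀ᶠ r in 𝓝[>] (0 : ℝ), r ∈ Set.Ioc 0 ε := Ioc_mem_nhdsGT hε
    obtain ⟨ρ, ⟨i1, i2⟩, i3⟩ := ((e1.and (e2.eventually (gt_mem_nhds hε))).and e3).exists
    exact ⟨ρ, i1.le, i2.le, i3.2, i3.1⟩
  have hKt := Params.tendsto_K hP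
  have hKB : Tendsto (fun l : ℕ => C * (B / (P.K₀ * 2 ^ l / 2 ^ P.l₀ - C))) atTop (𝓝 0) := by
    simpa [sub_eq_add_neg] using (tendsto_const_nhds (x := B)).div_atTop
      (tendsto_atTop_add_const_right _ (-C) hKt) |>.const_mul C
  obtain ⟨m, hm⟩ := eventually_atTop.1
    (((((((Params.tendsto_alpha hP).eventually_ge_atTop (max (max 1 (Q / ρ)) P.αδ)).and
      (hKt.eventually_gt_atTop C)).and (hKB.eventually (ge_mem_nhds hε))).and
      ((P.tendsto_K_mul_sq C ‖b - a‖).eventually (ge_mem_nhds hρ))).and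
      ((Params.tendsto_alpha_mul_rpow hP A hθ).eventually (ge_mem_nhds hρ))).and
      (eventually_gt_atTop P.l₀))
  have hEα : ∀ k, m ≤ (t.state k).l → ∀ r, 0 ≤ r → Er r ≤ (t.state k).α * r + ε := by
    intro k hk r hr
    obtain ⟨⟨⟨⟨⟨i1, -⟩, -⟩, -⟩, -⟩, -⟩ := hm _ hk
    rw [← (ht.α_K_eq k).2.1] at i1
    have hα1 : 1 ≤ (t.state k).α := (le_max_left _ _).trans ((le_max_left _ _).trans i1)
    have hαQ : Q / ρ ≤ (t.state k).α := (le_max_right _ _).trans ((le_max_left _ _).trans i1)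
    rw [div_le_iff₀ hρ] at hαQ
    -- For `r ≤ ρ` the error is at most `Er ρ ≤ ε`; beyond `ρ` it is at most `Q ≤ α ρ ≤ α r`.
    rcases le_total r ρ with h | h
    · have := hEm hr hρ.le h
      have : 0 ≤ (t.state k).α * r := by positivity
      linarith
    · have := (hErQ r hr).2
      have : (t.state k).α * ρ ≤ (t.state k).α * r := by gcongr
      linarith
  -- Level `m + 1` guarantees that a refinement from a level at least `m` has occurred. The bound is
  -- `2 ε` because that refinement raises `α` by `αδ ≤ α`; afterwards, until the next refinement,
  -- `α` is fixed and `σ` can only decrease.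
  have hgood : ∀ k, m + 1 ≤ (t.state k).l → ∃ x ∈ (t.state k).S,
      (t.state k).α * (t.state k).unc σ x ≤ 2 * ε ∧ (t.state k).unc σ x ≤ ρ ∧
        f x ≤ f xs + 5 * ε := by
    intro k
    induction k with
    | zero =>
      intro h
      have := (hm m le_rfl).2
      rw [ht.initial.level] at h
      omega
    | succ k ih =>
      intro hk
      have hpers : (t.state (k + 1)).l = (t.state k).l → (t.state (k + 1)).α = (t.state k).α →
          ∃ x ∈ (t.state (k + 1)).S, (t.state (k + 1)).α * (t.state (k + 1)).unc σ x ≤ 2 * ε ∧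
            (t.state (k + 1)).unc σ x ≤ ρ ∧ f x ≤ f xs + 5 * ε := by
        intro hl hα
        rw [hl] at hk
        obtain ⟨x, hx, j1, j2, j3⟩ := ih hk
        have e : (t.state (k + 1)).unc σ x ≤ (t.state k).unc σ x :=
          hσ.anti x (ht.S_subset_box hab k hx) _ _ (ht.one_le_N hP k hx) (ht.N_le_succ k hx)
        obtain ⟨⟨⟨⟨⟨i1, -⟩, -⟩, -⟩, -⟩, -⟩ := hm _ ((Nat.le_succ m).trans hk)
        rw [← (ht.α_K_eq k).2.1] at i1
        have hα1 : 1 ≤ (t.state k).α := (le_max_left _ _).trans ((le_max_left _ _).trans i1)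
        refine ⟨x, ht.S_subset_succ k hx, ?_, e.trans j2, j3⟩
        rw [hα]
        exact (mul_le_mul_of_nonneg_left e (by linarith)).trans j1
      rcases ht.step_cases k with ⟨_, h⟩ | ⟨_, h⟩ | ⟨hcase, hzq, h⟩
      · exact hpers (by rw [h]) (by rw [h])
      · exact hpers (by rw [h]) (by rw [h])
      · have hk' : m ≤ (t.state k).l := by
          rw [h] at hk
          exact Nat.le_of_succ_le_succ hk
        obtain ⟨⟨⟨⟨⟨i1, i2⟩, i3⟩, i4⟩, i5⟩, i6⟩ := hm _ hk'
        -- The Hessian bound excludes the regression at iteration 0; a level above `l₀` rules that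
        -- iteration out.
        have hk0 : 0 < k := by
          rcases Nat.eq_zero_or_pos k with rfl | hpos
          · rw [ht.initial.level] at i6
            exact absurd i6 (lt_irrefl _)
          · exact hpos
        rw [← (ht.α_K_eq k).2.1] at i1 i5
        rw [← (ht.α_K_eq k).2.2] at i2 i3 i4
        have hα1 : 1 ≤ (t.state k).α := (le_max_left _ _).trans ((le_max_left _ _).trans i1)
        have hN : ∀ x ∈ box a b, ∀ N : ℕ, 1 ≤ N → P.γ * 2 ^ (t.state k).l ≤ N →
            (t.state k).α * σ x N ≤ ρ := by
          intro x hx N hN hle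
          refine le_trans ?_ i5
          refine mul_le_mul_of_nonneg_left ((hdec x hx N hN).trans ?_) (by linarith)
          refine mul_le_mul_of_nonneg_left ?_ hA.le
          exact Real.rpow_le_rpow_of_nonpos (mul_pos hP.γ_pos (by positivity)) hle (by linarith)
        obtain ⟨x, hx, j1, j2, j3⟩ := ht.exists_accurate hab hP hσ hC (hp k hk0) hf hEm hEr hxs
          (le_max_left _ _) (hpB k) hρ.le hρε hEρ hβρ hα1 (hEα k hk') i2 i3 i4 hN hcase hzq
        refine ⟨x, ht.S_subset_succ k hx, ?_, ?_, j3⟩ <;> rw [h]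
        · have e0 : 0 ≤ (t.state k).unc σ x :=
            hσ.nonneg x (ht.S_subset_box hab k hx) _ (ht.one_le_N hP k hx)
          have e1 := mul_le_mul_of_nonneg_right ((le_max_right _ _).trans i1) e0
          change ((t.state k).α + P.αδ) * (t.state k).unc σ x ≤ 2 * ε
          linarith
        · exact j2
  filter_upwards [(ht.tendsto_level hP).eventually_ge_atTop (m + 1)] with k hk
  obtain ⟨x, hx, j1, j2, j3⟩ := hgood k hk
  have hS := ht.S_subset_box hab k
  have hηS := (hη k).1
  have c1 := (hη k).2 x hx
  have c2 := abs_le.1 (hEr x (hS hx) _ (ht.one_le_N hP k hx))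
  have c3 := hEm (hσ.nonneg x (hS hx) _ (ht.one_le_N hP k hx)) hρ.le j2
  have c4 := abs_le.1 (hEr _ (hS hηS) _ (ht.one_le_N hP k hηS))
  have c5 := hEα k ((Nat.le_succ m).trans hk) _ (hσ.nonneg _ (hS hηS) _ (ht.one_le_N hP k hηS))
  -- The total of 9: `ε` for `f` against `y + α σ` at the candidate, `2 ε` for `α σ` and `ε` for the
  -- measurement error at `x`, and `5 ε` for the value of `f` there.
  unfold State.y State.unc at *
  linarith [c2.2, c4.1]

end Run

end AlphaDogs

theorem mainTheorem1 {n : ℕ} (a b : AlphaDogs.E n) (hab : ∀ i, a i < b i)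
    (g : AlphaDogs.E n → ℕ → ℝ) (f : AlphaDogs.E n → ℝ) (σ : AlphaDogs.E n → ℕ → ℝ)
    (P : AlphaDogs.Params) (hP : P.Valid)
    (t : AlphaDogs.Trace n) (ht : AlphaDogs.IsRun a b g σ P t)
    (hf : AlphaDogs.IsTimeAverage (AlphaDogs.box a b) g f)
    (hσ : AlphaDogs.IsUncertainty (AlphaDogs.box a b) σ)
    (h1 : AlphaDogs.HessianAssumption (AlphaDogs.box a b) f t.p)
    (h2 : AlphaDogs.ErrorAssumption (AlphaDogs.box a b) g σ f)
    (h3 : AlphaDogs.DecayAssumption (AlphaDogs.box a b) σ)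
    (η : ℕ → AlphaDogs.E n) (hη : ∀ k, AlphaDogs.IsCandidate g σ (t.state k) (η k))
    (xs : AlphaDogs.E n) (hxs : xs ∈ AlphaDogs.box a b)
    (hmin : ∀ x ∈ AlphaDogs.box a b, f xs ≤ f x) :
    Filter.Tendsto (fun k => f (η k)) Filter.atTop (nhds (f xs)) ∧
      Filter.Tendsto (fun k => AlphaDogs.regret f xs (η k)) Filter.atTop (nhds 0) := by
  have hlim : Tendsto (fun k => f (η k)) atTop (𝓝 (f xs)) := by
    refine tendsto_order.2 ⟨fun c hc => Eventually.of_forall fun k =>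
      hc.trans_le (hmin _ (ht.S_subset_box hab k (hη k).1)), fun c hc => ?_⟩
    filter_upwards [ht.eventually_candidate_le hab hP hσ h1 h2 h3 hη hxs
      (ε := (c - f xs) / 10) (by linarith)] with k hk
    linarith
  refine ⟨hlim, ?_⟩
  simpa only [AlphaDogs.regret, sub_self] using hlim.sub_const (f xs)
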